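/- Let $p$ be a prime, $r\ge 1$, $n=p^r-1$, and let $R$ be $\mathbb Z$ or $\mathbb Z/p\mathbb Z$. Let $W=S_{n+1}$ be the Weyl group of the adjoint group $G=PGL_{n+1}$ of type $A_n$, with simple roots $\alpha_1,\dots,\alpha_n$ and simple reflections $s_1,\dots,s_n$, and let $W_P=\langle s_2,\dots,s_n\rangle$ be the Weyl group of (the Levi part of) the maximal parabolic subgroup $P$ generated by all simple reflections except the first one, so that $G/P=\mathbb P^n$. Let $S=R[\alpha_1,\dots,\alpha_n]$ be the symmetric algebra of the root lattice over $R$, $Q$ its localization at all roots, and $Q_W=\bigoplus_{w\in W}Q\,\delta_w$ the twisted group algebra, $(q\delta_w)(q'\delta_v)=q\,w(q')\,\delta_{wv}$. Let $\mathbf D\subset Q_W$ be the nil-Hecke algebra, i.e. the subring generated by $S$ and the Demazure elements $X_\alpha=\alpha^{-1}(1-\delta_{s_\alpha})$ for all roots $\alpha$. Let $\mathbf D_P$ be the image of $\mathbf D$ under the projection $Q_W\to Q_{W/W_P}$, $q\delta_w\mapsto q\delta_{wW_P}$, onto the free $Q$-module with basis $W/W_P$, and let $\mathbf D_P^\star=\mathrm{Hom}_S(\mathbf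 D_P,S)$, identified with the set of functionals in $\mathrm{Hom}_Q(Q_{W/W_P},Q)$ that take values in $S$ on $\mathbf D_P$. The algebra $\mathbf D$ acts on $\mathbf D_P^\star$ by restriction of the action $q\delta_w\odot q'f_v=q\,w(q')f_{wv}$ of $Q_W$, where $(f_v)_{v\in W/W_P}$ is the basis dual to $(\delta_v)_{v\in W/W_P}$. Then the $\mathbf D$-module $\mathbf D_P^\star$ is indecomposable: it is nonzero, and it is not the direct sum of two nonzero $\mathbf D$-submodules. -/

import Mathlib

noncomputable section

namespace NilHecke

/-- A module is indecomposable if it is nonzero and is not the direct sum of two nonzero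
submodules. -/
def IsIndecomposable (A M : Type*) [Ring A] [AddCommGroup M] [Module A M] : Prop :=
  Nontrivial M ∧ ∀ N₁ N₂ : Submodule A M, IsCompl N₁ N₂ → N₁ = ⊥ ∨ N₂ = ⊥

variable (R : Type*) [CommRing R] (n : ℕ)

/-- The Weyl group of type `A_n`. -/
abbrev W : Type := Equiv.Perm (Fin (n + 1))

/-- The simple reflections; `simpleRefl n i` is the `(i + 1)`-st one. -/
def simpleRefl (i : Fin n) : W n := Equiv.swap i.castSucc i.succ

/-- The parabolic subgroup generated by all simple reflections except the first one. -/
def WP : Subgroup (W n) := Subgroup.closure {s | ∃ i : Fin n, i.val ≠ 0 ∧ s = simpleRefl n i}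

/-- The polynomial ring over `R` in the simple roots; the variable `X i` is the `(i + 1)`-st
simple root `ε_i - ε_{i+1}`. This is the symmetric algebra over `R` of the root lattice. -/
abbrev S : Type _ := MvPolynomial (Fin n) R

/-- The element `ε_a - ε_0` of the root lattice. -/
def eps (a : Fin (n + 1)) : S R n :=
  -∑ k ∈ Finset.univ.filter (fun k : Fin n => k.castSucc < a), MvPolynomial.X k

/-- The root `ε_a - ε_b`. -/
def root (a b : Fin (n + 1)) : S R n := eps R n a - eps R n b

lemma root_simple (i : Fin n) : root R n i.castSucc i.succ = MvPolynomial.X i := by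
  have h : Finset.univ.filter (fun k : Fin n => k.castSucc < i.succ) =
      insert i (Finset.univ.filter (fun k : Fin n => k.castSucc < i.castSucc)) := by
    ext k
    simp only [Finset.mem_filter, Finset.mem_univ, true_and, Finset.mem_insert, Fin.lt_def,
      Fin.ext_iff, Fin.val_castSucc, Fin.val_succ]
    omega
  unfold root eps
  rw [h, Finset.sum_insert (by simp)]
  ring

/-- The action of `w` on polynomials in the roots, `ε_a - ε_b ↦ ε_{w a} - ε_{w b}`. -/
def actS (w : W n) : S R n →ₐ[R] S R n :=
  MvPolynomial.aeval fun k : Fin n => root R n (w k.castSucc) (w k.succ)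

lemma actS_root (w : W n) (a b : Fin (n + 1)) :
    actS R n w (root R n a b) = root R n (w a) (w b) := by
  have key : ∀ a : Fin (n + 1), actS R n w (root R n 0 a) = root R n (w 0) (w a) := by
    intro a
    induction a using Fin.induction with
    | zero => simp [root]
    | succ i ih =>
      have h : root R n 0 i.succ = root R n 0 i.castSucc + root R n i.castSucc i.succ := by
        simp [root]
      rw [h, map_add, ih, root_simple, actS, MvPolynomial.aeval_X]
      simp [root]
  have h : root R n a b = root R n 0 b - root R n 0 a := by simp [root]
  rw [h, map_sub, key, key]
  simp [root]

lemma actS_one : actS R n 1 = AlgHom.id R (S R n) := by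
  ext k
  simp [actS, root_simple]

lemma actS_mul (v w : W n) : actS R n (v * w) = (actS R n v).comp (actS R n w) := by
  ext1 k
  rw [AlgHom.comp_apply, ← root_simple R n k, actS_root, actS_root, actS_root]
  rfl

/-- The multiplicative set generated by all roots. -/
def rootMonoid : Submonoid (S R n) :=
  Submonoid.closure {x | ∃ a b : Fin (n + 1), a ≠ b ∧ x = root R n a b}

lemma root_mem {a b : Fin (n + 1)} (h : a ≠ b) : root R n a b ∈ rootMonoid R n :=
  Submonoid.subset_closure ⟨a, b, h, rfl⟩

lemma rootMonoid_le (w : W n) :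
    rootMonoid R n ≤ (rootMonoid R n).comap (actS R n w : S R n →+* S R n) := by
  refine Submonoid.closure_le.2 ?_
  rintro x ⟨a, b, h, rfl⟩
  change actS R n w (root R n a b) ∈ rootMonoid R n
  rw [actS_root]
  exact root_mem R n (fun e => h (w.injective e))

/-- The localization of `S` at all roots. -/
def Q : Type _ := Localization (rootMonoid R n)

instance : CommRing (Q R n) := inferInstanceAs (CommRing (Localization (rootMonoid R n)))

instance : Algebra (S R n) (Q R n) :=
  inferInstanceAs (Algebra (S R n) (Localization (rootMonoid R n)))

instance : IsLocalization (rootMonoid R n) (Q R n) :=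
  inferInstanceAs (IsLocalization (rootMonoid R n) (Localization (rootMonoid R n)))

/-- The action of `w` on the localization, extending `actS`. -/
def actQ (w : W n) : Q R n →+* Q R n :=
  IsLocalization.map (Q R n) (actS R n w : S R n →+* S R n) (rootMonoid_le R n w)

lemma actQ_algebraMap (w : W n) (f : S R n) :
    actQ R n w (algebraMap (S R n) (Q R n) f) = algebraMap (S R n) (Q R n) (actS R n w f) :=
  IsLocalization.map_eq (rootMonoid_le R n w) f

lemma actQ_one : actQ R n 1 = RingHom.id (Q R n) := by
  refine IsLocalization.ringHom_ext (rootMonoid R n) ?_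
  refine RingHom.ext fun f => ?_
  simp [actQ_algebraMap, actS_one]

lemma actQ_mul (v w : W n) : actQ R n (v * w) = (actQ R n v).comp (actQ R n w) := by
  refine IsLocalization.ringHom_ext (rootMonoid R n) ?_
  refine RingHom.ext fun f => ?_
  simp [actQ_algebraMap, actS_mul]

instance : MulSemiringAction (W n) (Q R n) where
  smul w q := actQ R n w q
  one_smul q := by change actQ R n 1 q = q; rw [actQ_one]; rfl
  mul_smul v w q := by
    change actQ R n (v * w) q = actQ R n v (actQ R n w q); rw [actQ_mul]; rfl
  smul_zero w := map_zero (actQ R n w)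
  smul_add w := map_add (actQ R n w)
  smul_one w := map_one (actQ R n w)
  smul_mul w := map_mul (actQ R n w)

lemma smul_algebraMap_eq (w : W n) (f : S R n) :
    w • algebraMap (S R n) (Q R n) f = algebraMap (S R n) (Q R n) (actS R n w f) :=
  actQ_algebraMap R n w f

/-- The localized twisted group algebra: `single w q` is `q δ_w`, with
`(q δ_w) (q' δ_v) = q w(q') δ_{w v}`. -/
abbrev QW : Type _ := SkewMonoidAlgebra (Q R n) (W n)

/-- The inverse of the root `ε_a - ε_b` in the localization. -/
def invRoot {a b : Fin (n + 1)} (h : a ≠ b) : Q R n :=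
  IsLocalization.mk' (Q R n) 1 (⟨root R n a b, root_mem R n h⟩ : rootMonoid R n)

lemma invRoot_mul {a b : Fin (n + 1)} (h : a ≠ b) :
    invRoot R n h * algebraMap (S R n) (Q R n) (root R n a b) = 1 := by
  have := IsLocalization.mk'_spec (Q R n) (1 : S R n)
    (⟨root R n a b, root_mem R n h⟩ : rootMonoid R n)
  rwa [map_one] at this

/-- The Demazure element `α⁻¹ (1 - δ_{s_α})` of the root `α = ε_a - ε_b`. -/
def demazure {a b : Fin (n + 1)} (h : a ≠ b) : QW R n :=
  SkewMonoidAlgebra.single 1 (invRoot R n h) * (1 - SkewMonoidAlgebra.single (Equiv.swap a b) 1)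

/-- The element `f δ_1` for a polynomial `f`. -/
def scalar (f : S R n) : QW R n := SkewMonoidAlgebra.single 1 (algebraMap (S R n) (Q R n) f)

/-- The nil-Hecke algebra: the subring of the localized twisted group algebra that is
generated by the polynomials and the Demazure elements of all roots. -/
def D : Subring (QW R n) :=
  Subring.closure (Set.range (scalar R n) ∪
    {x | ∃ (a b : Fin (n + 1)) (h : a ≠ b), x = demazure R n h})

/-- The free module on the cosets `W / W_P`. -/
abbrev QWP : Type _ := (W n ⧸ WP n) →₀ Q R n

/-- The projection `q δ_w ↦ q δ_{w W_P}`. -/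
def proj : QW R n →+ QWP R n where
  toFun d := Finsupp.mapDomain (fun w : W n => (w : W n ⧸ WP n)) d.coeff
  map_zero' := by simp
  map_add' x y := by simp [Finsupp.mapDomain_add]

/-- The image of the nil-Hecke algebra in the free module on `W / W_P`. -/
def DP : AddSubgroup (QWP R n) := (D R n).toAddSubgroup.map (proj R n)

/-- The `Q`-dual of the free module on `W / W_P`; a function `z` stands for the functional
`∑ z(v) f_v`, where `f_v` is the dual basis. -/
def QDual : Type _ := (W n ⧸ WP n) → Q R n

instance : AddCommGroup (QDual R n) := inferInstanceAs (AddCommGroup ((W n ⧸ WP n) → Q R n))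

/-- The value of a functional on an element of the free module on `W / W_P`. -/
def pairing (z : QDual R n) : QWP R n →+ Q R n :=
  Finsupp.liftAddHom fun v => AddMonoidHom.mulRight (z v)

/-- Multiplication of functionals by `q`. -/
def mulEnd : Q R n →+* AddMonoid.End (QDual R n) where
  toFun q :=
    { toFun := fun z v => q * z v
      map_zero' := funext fun _ => mul_zero q
      map_add' := fun _ _ => funext fun _ => mul_add q _ _ }
  map_one' := by ext z; exact funext fun _ => one_mul _
  map_mul' p q := by ext z; exact funext fun _ => mul_assoc _ _ _
  map_zero' := by ext z; exact funext fun _ => zero_mul _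
  map_add' p q := by ext z; exact funext fun _ => add_mul _ _ _

/-- The action of `δ_w` on functionals, `p f_v ↦ w(p) f_{w v}`. -/
def deltaEnd : W n →* AddMonoid.End (QDual R n) where
  toFun w :=
    { toFun := fun z v => w • z (w⁻¹ • v)
      map_zero' := funext fun _ => smul_zero w
      map_add' := fun _ _ => funext fun _ => smul_add w _ _ }
  map_one' := by
    ext z
    refine funext fun v => ?_
    change (1 : W n) • z ((1 : W n)⁻¹ • v) = z v
    simp
  map_mul' u w := by
    ext z
    refine funext fun v => ?_
    change (u * w) • z ((u * w)⁻¹ • v) = u • w • z (w⁻¹ • u⁻¹ • v)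
    rw [mul_smul, mul_inv_rev, mul_smul]

/-- The ring homomorphism giving the action `q δ_w ⊙ p f_v = q w(p) f_{w v}`. -/
def odotHom : QW R n →+* AddMonoid.End (QDual R n) :=
  SkewMonoidAlgebra.liftNCRingHom (mulEnd R n) (deltaEnd R n) (by
    intro q w
    ext z
    refine funext fun v => ?_
    change (w • q) * (w • z (w⁻¹ • v)) = w • (q * z (w⁻¹ • v))
    rw [smul_mul'])

instance : Module (QW R n) (QDual R n) := Module.compHom (QDual R n) (odotHom R n)

lemma single_smul_apply (w : W n) (q : Q R n) (z : QDual R n) (v : W n ⧸ WP n) :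
    ((SkewMonoidAlgebra.single w q : QW R n) • z) v = q * w • z (w⁻¹ • v) := by
  change (odotHom R n (SkewMonoidAlgebra.single w q) z) v = _
  have : odotHom R n (SkewMonoidAlgebra.single w q) = mulEnd R n q * deltaEnd R n w :=
    SkewMonoidAlgebra.liftNC_single _ _ _ _
  rw [this]
  rfl

lemma pairing_single (z : QDual R n) (v : W n ⧸ WP n) (q : Q R n) :
    pairing R n z (Finsupp.single v q) = q * z v := by
  simp [pairing]

lemma proj_single (w : W n) (q : Q R n) :
    proj R n (SkewMonoidAlgebra.single w q) = Finsupp.single (w : W n ⧸ WP n) q := by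
  simp [proj, Finsupp.mapDomain_single]

lemma pairing_add (z z' : QDual R n) (u : QWP R n) :
    pairing R n (z + z') u = pairing R n z u + pairing R n z' u := by
  induction u using Finsupp.induction_linear with
  | zero => simp
  | add f g hf hg => rw [map_add, map_add, map_add, hf, hg]; abel
  | single v q =>
    simp only [pairing_single]
    exact mul_add q (z v) (z' v)

lemma pairing_scalar (f : S R n) (z : QDual R n) (u : QWP R n) :
    pairing R n (scalar R n f • z) u = algebraMap _ (Q R n) f * pairing R n z u := by
  induction u using Finsupp.induction_linear with
  | zero => simp
  | add a b ha hb => rw [map_add, map_add, ha, hb, mul_add]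
  | single v q =>
    simp only [pairing_single, scalar, single_smul_apply, inv_one, one_smul]
    ring

lemma pairing_proj_scalar (f : S R n) (z : QDual R n) (d : QW R n) :
    pairing R n z (proj R n (scalar R n f * d)) =
      algebraMap _ (Q R n) f * pairing R n z (proj R n d) := by
  induction d using SkewMonoidAlgebra.induction_on with
  | zero => simp
  | add a b ha hb => rw [mul_add, map_add, map_add, map_add, map_add, ha, hb, mul_add]
  | single w q =>
    simp only [scalar, SkewMonoidAlgebra.single_mul_single, proj_single, pairing_single, one_mul,
      one_smul]
    ring

lemma pairing_delta (w : W n) (z : QDual R n) (d : QW R n) :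
    pairing R n ((SkewMonoidAlgebra.single w 1 : QW R n) • z) (proj R n d) =
      w • pairing R n z (proj R n (SkewMonoidAlgebra.single w⁻¹ 1 * d)) := by
  induction d using SkewMonoidAlgebra.induction_on with
  | zero => simp
  | add a b ha hb => rw [mul_add, map_add, map_add, map_add, map_add, ha, hb, smul_add]
  | single v q =>
    simp only [SkewMonoidAlgebra.single_mul_single, proj_single, pairing_single, one_mul,
      single_smul_apply, smul_mul', smul_inv_smul]
    rfl

/-- The ordinary divided difference preserves polynomials: `f - s_α(f)` is divisible by `α`. -/
lemma root_dvd {a b : Fin (n + 1)} (f : S R n) :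
    root R n a b ∣ f - actS R n (Equiv.swap a b) f := by
  have hr : ∀ c d : Fin (n + 1),
      root R n a b ∣ root R n c d - root R n (Equiv.swap a b c) (Equiv.swap a b d) := by
    have he : ∀ c : Fin (n + 1), root R n a b ∣ eps R n c - eps R n (Equiv.swap a b c) := by
      intro c
      rcases eq_or_ne c a with rfl | h1
      · rw [Equiv.swap_apply_left]; exact dvd_refl _
      · rcases eq_or_ne c b with rfl | h2
        · rw [Equiv.swap_apply_right]
          exact ⟨-1, by unfold root; ring⟩
        · rw [Equiv.swap_apply_of_ne_of_ne h1 h2, sub_self]; exact dvd_zero _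
    intro c d
    have := dvd_sub (he c) (he d)
    convert this using 1
    unfold root; ring
  induction f using MvPolynomial.induction_on with
  | C r =>
    have : actS R n (Equiv.swap a b) (MvPolynomial.C r) = MvPolynomial.C r := by
      simp [actS]
    rw [this, sub_self]; exact dvd_zero _
  | add p q hp hq =>
    rw [map_add]
    convert dvd_add hp hq using 1
    ring
  | mul_X p i hp =>
    rw [map_mul]
    have hX : root R n a b ∣ MvPolynomial.X i - actS R n (Equiv.swap a b) (MvPolynomial.X i) := by
      rw [← root_simple R n i, actS_root]; exact hr _ _
    convert dvd_add (hp.mul_right (MvPolynomial.X i))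
      (hX.mul_left (actS R n (Equiv.swap a b) p)) using 1
    ring

lemma root_mul_demazure {a b : Fin (n + 1)} (h : a ≠ b) :
    scalar R n (root R n a b) * demazure R n h =
      1 - SkewMonoidAlgebra.single (Equiv.swap a b) 1 := by
  rw [demazure, ← mul_assoc, scalar, SkewMonoidAlgebra.single_mul_single, one_smul, mul_comm,
    invRoot_mul, mul_one]
  exact one_mul _

/-- The dual `Hom_S(D_P, S)`, realized inside the `Q`-dual of the free module on `W / W_P` as the
functionals that take values in `S` on `D_P`; it is stable under the nil-Hecke algebra. (Since
`D_P` contains all `δ_v`, its elements are exactly the extensions of the `S`-linear maps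
`D_P → S`, each of which extends uniquely.) -/
def DPDual : Submodule (D R n) (QDual R n) where
  carrier := {z | ∀ u ∈ DP R n, pairing R n z u ∈ (algebraMap (S R n) (Q R n)).range}
  zero_mem' := by
    intro u _
    have h0 : pairing R n 0 u = 0 := by
      have := pairing_add R n 0 0 u
      rw [add_zero] at this
      exact left_eq_add.mp this
    rw [h0]; exact zero_mem _
  add_mem' := by
    intro z z' hz hz' u hu
    rw [pairing_add]
    exact add_mem (hz u hu) (hz' u hu)
  smul_mem' := by
    rintro ⟨d, hd⟩ z hz
    change ∀ u ∈ DP R n, pairing R n (d • z) u ∈ (algebraMap (S R n) (Q R n)).range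
    have hadd : ∀ (x y : QW R n) (z : QDual R n) (u : QWP R n),
        pairing R n ((x + y) • z) u = pairing R n (x • z) u + pairing R n (y • z) u := by
      intro x y z u
      rw [add_smul, pairing_add]
    have h0 : ∀ (z : QDual R n) (u : QWP R n), pairing R n ((0 : QW R n) • z) u = 0 := by
      intro z u
      have := hadd 0 0 z u
      rw [add_zero] at this
      exact left_eq_add.mp this
    have hneg : ∀ (x : QW R n) (z : QDual R n) (u : QWP R n),
        pairing R n ((-x) • z) u = -pairing R n (x • z) u := by
      intro x z u
      have := hadd x (-x) z u
      rw [add_neg_cancel, h0] at this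
      exact (neg_eq_of_add_eq_zero_right this.symm).symm
    induction hd using Subring.closure_induction generalizing z with
    | mem x hx =>
      rcases hx with ⟨f, rfl⟩ | ⟨a, b, h, rfl⟩
      · intro u hu
        rw [pairing_scalar]
        exact mul_mem ⟨f, rfl⟩ (hz u hu)
      · rintro _ ⟨d, hd, rfl⟩
        have hd : d ∈ D R n := hd
        have hX : demazure R n h ∈ D R n :=
          Subring.subset_closure (Or.inr ⟨a, b, h, rfl⟩)
        obtain ⟨f, hf⟩ := hz _ ⟨d, hd, rfl⟩
        obtain ⟨g, hg⟩ := hz _ ⟨demazure R n h * d, (D R n).mul_mem hX hd, rfl⟩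
        obtain ⟨e, he⟩ := root_dvd R n (a := a) (b := b) f
        set s := Equiv.swap a b with hs
        have hs' : actS R n s (root R n a b) = -root R n a b := by
          rw [actS_root, hs, Equiv.swap_apply_left, Equiv.swap_apply_right]
          unfold root; ring
        have hsd : (SkewMonoidAlgebra.single s⁻¹ 1 : QW R n) * d =
            d + -(scalar R n (root R n a b) * (demazure R n h * d)) := by
          rw [← mul_assoc, root_mul_demazure, hs, Equiv.swap_inv]
          noncomm_ring
        have h1 : pairing R n ((SkewMonoidAlgebra.single s 1 : QW R n) • z) (proj R n d) =
            algebraMap _ (Q R n) (actS R n s f + root R n a b * actS R n s g) := by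
          rw [pairing_delta, hsd, map_add, map_add, map_neg, map_neg, pairing_proj_scalar,
            ← hf, ← hg, ← map_mul, ← map_neg, ← map_add, smul_algebraMap_eq, map_add, map_neg,
            map_mul, hs']
          congr 1
          ring
        have h2 : algebraMap (S R n) (Q R n) (root R n a b) *
            pairing R n (demazure R n h • z) (proj R n d) =
            algebraMap (S R n) (Q R n) (root R n a b * (e - actS R n s g)) := by
          rw [← pairing_scalar, ← mul_smul, root_mul_demazure, sub_eq_add_neg, hadd, hneg,
            one_smul, ← hf, h1, ← map_neg, ← map_add]
          congr 1
          linear_combination he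
        refine ⟨e - actS R n s g, ?_⟩
        have h3 := congrArg (fun t => invRoot R n h * t) h2
        simp only [map_mul, ← mul_assoc, invRoot_mul, one_mul] at h3
        exact h3.symm
    | zero => intro u _; rw [h0]; exact zero_mem _
    | one => rw [one_smul]; exact hz
    | add x y _ _ hx hy => intro u hu; rw [hadd]; exact add_mem (hx hz u hu) (hy hz u hu)
    | neg x _ hx => intro u hu; rw [hneg]; exact neg_mem (hx hz u hu)
    | mul x y _ _ hx hy => rw [mul_smul]; exact hx (hy hz)

end NilHecke

end

noncomputable section

namespace NilHecke

/-! ### The cosets of `W_P` are the points `0, …, n`. -/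

section Combinatorics

variable (n : ℕ)

/-! Write `e_a` for `ε_a - ε_0`. A coset `w W_P` is the point `w 0`, and the dual is `S[X] / ∏ (X -
e_a)`: a polynomial `g` gives the functional with value `g(e_a)` at the point `a`. These functionals
are integral on `D_P` (`ev_mem`). Conversely, Newton interpolation along the points produces every
integral functional, with degree at most `n` (`exists_ev_eq`). The element `δ_w` acts by `w` on
coefficients and by `X ↦ X - e_{w 0}`.

A decomposition gives an idempotent `D`-endomorphism `φ`, hence an idempotent matrix `Φ` over `S` in
the basis of powers of `X`. The point classes `∏_{b ≠ a} (X - e_b)` are permuted by `W`, so if `φ`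
maps the class of `0` to `∑ a_k X^k`, then each `a_k` is `W_P`-invariant and the class of `w 0` goes
to `∑ w(a_k) (X - e_{w 0})^k`.

The prime power enters through the `a_k`. They are symmetric polynomials in the `ε_0 - ε_{i+1}`, and
`w` turns the elementary ones into values at `e_{w 0}` of Hasse derivatives of `F = ∏ (X - e_a)`, of
orders `1, …, n`. Modulo `p` and the roots, `F` becomes `X ^ p^r`, whose Hasse derivatives of these
orders vanish. Thus `w(a_k)` is the value at `e_{w 0}` of a polynomial that reduces to a constant
(`exists_eval_eq_actS`).

Comparing coefficients modulo `F` and reducing, `Φ` becomes upper triangular with constant diagonal,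
because `(n choose l) = (-1)^l` modulo `p` (`map_matrix_upper`). An idempotent of this shape over a
field is `0` or `1`, and Krull's intersection theorem lifts this to `Φ`. -/

lemma apply_zero_of_mem_WP {w : W n} (hw : w ∈ WP n) : w 0 = 0 := by
  induction hw using Subgroup.closure_induction with
  | mem x hx =>
    obtain ⟨i, hi, rfl⟩ := hx
    refine Equiv.swap_apply_of_ne_of_ne ?_ ?_
    · simpa [Fin.ext_iff, eq_comm] using hi
    · exact (Fin.succ_ne_zero i).symm
  | one => rfl
  | mul x y _ _ hx hy => rw [Equiv.Perm.mul_apply, hy, hx]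
  | inv x _ hx => rw [Equiv.Perm.inv_eq_iff_eq, hx]

/-- A group generated by transpositions contains every permutation that preserves its orbits, and
the simple reflections other than the first join all nonzero points into one orbit. -/
lemma mem_WP_iff {w : W n} : w ∈ WP n ↔ w 0 = 0 := by
  refine ⟨apply_zero_of_mem_WP n, fun hw => ?_⟩
  unfold WP
  rw [mem_closure_isSwap]
  · refine ⟨Set.toFinite _, ?_⟩
    have step : ∀ i : Fin n, i.val ≠ 0 → i.castSucc ∈ MulAction.orbit (WP n) i.succ := by
      intro i hi
      refine ⟨⟨simpleRefl n i, Subgroup.subset_closure ⟨i, hi, rfl⟩⟩, ?_⟩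
      exact Equiv.swap_apply_right _ _
    -- The point `1` is given by its value, since it does not exist when `n = 0`.
    have key : ∀ a : Fin (n + 1), a ≠ 0 → ∀ b : Fin (n + 1), b.val = 1 →
        b ∈ MulAction.orbit (WP n) a := by
      intro a
      induction a using Fin.induction with
      | zero => exact fun h => absurd rfl h
      | succ i ih =>
        intro _ b hb
        by_cases hi : i.val = 0
        · have : b = i.succ := by ext; simp [hb, hi]
          rw [this]
          exact MulAction.mem_orbit_self _
        · have h1 := ih (by simpa [Fin.ext_iff] using hi) b hb
          rwa [MulAction.orbit_eq_iff.2 (step i hi)] at h1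
    intro x
    change w x ∈ MulAction.orbit (WP n) x
    by_cases hx : x = 0
    · subst hx
      rw [hw]
      exact MulAction.mem_orbit_self _
    · have hwx : w x ≠ 0 := fun h => hx (w.injective (h.trans hw.symm))
      have hn : 1 < n + 1 := by
        have := x.isLt
        have : x.val ≠ 0 := fun h => hx (Fin.ext h)
        omega
      have h1 := key x hx ⟨1, hn⟩ rfl
      have h2 := key (w x) hwx ⟨1, hn⟩ rfl
      rw [← MulAction.orbit_eq_iff.2 h1, MulAction.orbit_eq_iff.2 h2]
      exact MulAction.mem_orbit_self _
  · rintro _ ⟨i, _, rfl⟩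
    exact ⟨i.castSucc, i.succ, (Fin.castSucc_lt_succ).ne, rfl⟩

/-- The point `w 0` of a coset `w W_P`. -/
def pos : W n ⧸ WP n → Fin (n + 1) :=
  Quotient.lift (fun w : W n => w 0) (by
    intro a b h
    have h1 := QuotientGroup.leftRel_apply.1 h
    have h2 := apply_zero_of_mem_WP n h1
    rw [Equiv.Perm.mul_apply, Equiv.Perm.inv_eq_iff_eq] at h2
    exact h2.symm)

lemma pos_mk (w : W n) : pos n (w : W n ⧸ WP n) = w 0 := rfl

lemma pos_smul (w : W n) (v : W n ⧸ WP n) : pos n (w • v) = w (pos n v) := by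
  induction v using QuotientGroup.induction_on with
  | H u => rfl

lemma pos_injective : Function.Injective (pos n) := by
  intro u v h
  induction u using QuotientGroup.induction_on with
  | H u =>
  induction v using QuotientGroup.induction_on with
  | H v =>
    rw [pos_mk, pos_mk] at h
    refine QuotientGroup.eq.2 ((mem_WP_iff n).2 ?_)
    rw [Equiv.Perm.mul_apply, Equiv.Perm.inv_eq_iff_eq, h]

lemma pos_surjective : Function.Surjective (pos n) := fun j =>
  ⟨((Equiv.swap 0 j : W n) : W n ⧸ WP n), by rw [pos_mk, Equiv.swap_apply_left]⟩

end Combinatorics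

/-! ### Coordinates on the root lattice. -/

section Roots

variable (R : Type*) [CommRing R] (n : ℕ)

lemma eps_zero : eps R n 0 = 0 := by simp [eps]

lemma eps_succ (i : Fin n) : eps R n i.succ = eps R n i.castSucc - MvPolynomial.X i := by
  rw [← root_simple R n i, root]
  ring

lemma root_zero_right (a : Fin (n + 1)) : root R n a 0 = eps R n a := by
  rw [root, eps_zero, sub_zero]

lemma actS_eps (w : W n) (a : Fin (n + 1)) :
    actS R n w (eps R n a) = eps R n (w a) - eps R n (w 0) := by
  rw [← root_zero_right, actS_root, root]

lemma root_dvd_eps_sub (a b c : Fin (n + 1)) :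
    root R n a b ∣ eps R n c - eps R n (Equiv.swap a b c) := by
  rcases eq_or_ne c a with rfl | h1
  · rw [Equiv.swap_apply_left]; exact dvd_refl _
  · rcases eq_or_ne c b with rfl | h2
    · rw [Equiv.swap_apply_right]
      exact ⟨-1, by unfold root; ring⟩
    · rw [Equiv.swap_apply_of_ne_of_ne h1 h2, sub_self]; exact dvd_zero _

/-- The coordinates `ε_0 - ε_{i+1}` are polynomial generators of `S`. -/
def coordEquiv : MvPolynomial (Fin n) R ≃ₐ[R] S R n :=
  AlgEquiv.ofAlgHom
    (MvPolynomial.aeval fun i : Fin n => -eps R n i.succ)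
    -- `Fin.cases 0 X a` stands for `ε_0 - ε_a`, which is zero at `a = 0`; the simple root is a
    -- difference of two of these.
    (MvPolynomial.aeval fun i : Fin n =>
      (Fin.cases 0 MvPolynomial.X i.succ : MvPolynomial (Fin n) R) -
        (Fin.cases 0 MvPolynomial.X i.castSucc : MvPolynomial (Fin n) R))
    (by
      have h : ∀ a : Fin (n + 1), MvPolynomial.aeval (fun i : Fin n => -eps R n i.succ)
          (Fin.cases 0 MvPolynomial.X a : MvPolynomial (Fin n) R) = -eps R n a := by
        intro a
        cases a using Fin.cases with
        | zero => simp [eps_zero]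
        | succ i => simp
      ext1 i
      rw [AlgHom.comp_apply, MvPolynomial.aeval_X, map_sub, h, h, eps_succ]
      simp)
    (by
      set θ : S R n →ₐ[R] MvPolynomial (Fin n) R := MvPolynomial.aeval fun i : Fin n =>
        (Fin.cases 0 MvPolynomial.X i.succ : MvPolynomial (Fin n) R) -
          (Fin.cases 0 MvPolynomial.X i.castSucc : MvPolynomial (Fin n) R) with hθ
      have h : ∀ a : Fin (n + 1), θ (-eps R n a) =
          (Fin.cases 0 MvPolynomial.X a : MvPolynomial (Fin n) R) := by
        intro a
        induction a using Fin.induction with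
        | zero => simp [eps_zero]
        | succ i ih =>
          rw [eps_succ, neg_sub, sub_eq_add_neg, map_add, ih, hθ, MvPolynomial.aeval_X]
          ring
      ext1 i
      rw [AlgHom.comp_apply, MvPolynomial.aeval_X, h]
      simp)

lemma coordEquiv_X (i : Fin n) : coordEquiv R n (MvPolynomial.X i) = -eps R n i.succ := by
  simp [coordEquiv]

lemma eps_injective [Nontrivial R] : Function.Injective (eps R n) := by
  have h : ∀ a : Fin (n + 1), (coordEquiv R n).symm (-eps R n a) =
      (Fin.cases 0 MvPolynomial.X a : MvPolynomial (Fin n) R) := by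
    intro a
    cases a using Fin.cases with
    | zero => simp [eps_zero]
    | succ i => rw [← coordEquiv_X, AlgEquiv.symm_apply_apply]; rfl
  intro a b hab
  have h1 := (h a).symm.trans ((congrArg (fun x => (coordEquiv R n).symm (-x)) hab).trans (h b))
  cases a using Fin.cases with
  | zero =>
    cases b using Fin.cases with
    | zero => rfl
    | succ j => exact absurd h1.symm (MvPolynomial.X_ne_zero j)
  | succ i =>
    cases b using Fin.cases with
    | zero => exact absurd h1 (MvPolynomial.X_ne_zero i)
    | succ j => exact congrArg Fin.succ (MvPolynomial.X_injective h1)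

lemma root_ne_zero [Nontrivial R] {a b : Fin (n + 1)} (h : a ≠ b) : root R n a b ≠ 0 :=
  sub_ne_zero.2 fun e => h (eps_injective R n e)

lemma algebraMap_injective [IsDomain R] : Function.Injective (algebraMap (S R n) (Q R n)) := by
  refine IsLocalization.injective (M := rootMonoid R n) _ ?_
  refine Submonoid.closure_le.2 ?_
  rintro _ ⟨a, b, h, rfl⟩
  exact mem_nonZeroDivisors_of_ne_zero (root_ne_zero R n h)

end Roots

/-! ### Functionals given by polynomials in one variable. -/

section Evaluation

variable (R : Type*) [CommRing R] (n : ℕ)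

/-- The functional whose value at the coset `w W_P` is the value of the polynomial `g` at
`ε_{w 0} - ε_0`. -/
def ev (g : Polynomial (S R n)) : QDual R n := fun v =>
  algebraMap (S R n) (Q R n) (g.eval (eps R n (pos n v)))

lemma ev_apply (g : Polynomial (S R n)) (v : W n ⧸ WP n) :
    ev R n g v = algebraMap (S R n) (Q R n) (g.eval (eps R n (pos n v))) := rfl

lemma QDual.add_apply (z z' : QDual R n) (v : W n ⧸ WP n) : (z + z') v = z v + z' v := rfl

lemma QDual.sub_apply (z z' : QDual R n) (v : W n ⧸ WP n) : (z - z') v = z v - z' v := rfl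

lemma QDual.zero_apply (v : W n ⧸ WP n) : (0 : QDual R n) v = 0 := rfl

lemma ev_add (g h : Polynomial (S R n)) : ev R n (g + h) = ev R n g + ev R n h := by
  refine funext fun v => ?_
  rw [QDual.add_apply, ev_apply, ev_apply, ev_apply, Polynomial.eval_add, map_add]

lemma scalar_smul_apply (f : S R n) (z : QDual R n) (v : W n ⧸ WP n) :
    (scalar R n f • z) v = algebraMap (S R n) (Q R n) f * z v := by
  rw [scalar, single_smul_apply, inv_one, one_smul, one_smul]

lemma scalar_smul_ev (f : S R n) (g : Polynomial (S R n)) :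
    scalar R n f • ev R n g = ev R n (Polynomial.C f * g) := by
  refine funext fun v => ?_
  rw [scalar_smul_apply, ev_apply, ev_apply, Polynomial.eval_mul, Polynomial.eval_C, map_mul]

/-- The action of `w` on polynomials in one variable, acting as `actS` on the coefficients and
sending the variable `X` to `X - (ε_{w 0} - ε_0)`. -/
def polyAct (w : W n) : Polynomial (S R n) →+* Polynomial (S R n) :=
  Polynomial.eval₂RingHom (Polynomial.C.comp (actS R n w : S R n →+* S R n))
    (Polynomial.X - Polynomial.C (eps R n (w 0)))

lemma polyAct_C (w : W n) (f : S R n) :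
    polyAct R n w (Polynomial.C f) = Polynomial.C (actS R n w f) := by
  simp [polyAct]

lemma polyAct_X (w : W n) :
    polyAct R n w Polynomial.X = Polynomial.X - Polynomial.C (eps R n (w 0)) := by
  simp [polyAct]

/-- The shift of `X` compensates for the moved base point: `w` sends `ε_a - ε_0` to `ε_{w a} - ε_{w
0}`. -/
lemma eval_polyAct (w : W n) (g : Polynomial (S R n)) (a : Fin (n + 1)) :
    (polyAct R n w g).eval (eps R n (w a)) = actS R n w (g.eval (eps R n a)) := by
  induction g using Polynomial.induction_on' with
  | add p q hp hq => rw [map_add, Polynomial.eval_add, Polynomial.eval_add, map_add, hp, hq]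
  | monomial k f =>
    rw [← Polynomial.C_mul_X_pow_eq_monomial, map_mul, map_pow, polyAct_C, polyAct_X]
    simp [actS_eps]

lemma delta_smul_ev (w : W n) (g : Polynomial (S R n)) :
    (SkewMonoidAlgebra.single w 1 : QW R n) • ev R n g = ev R n (polyAct R n w g) := by
  refine funext fun v => ?_
  rw [single_smul_apply, one_mul, ev_apply, ev_apply, smul_algebraMap_eq, ← eval_polyAct,
    ← pos_smul, smul_inv_smul]

/-- Modulo the root, the reflection fixes both the coefficients and `X`. The quotient is the divided
difference of `g`. -/
lemma root_dvd_sub_polyAct (a b : Fin (n + 1)) (g : Polynomial (S R n)) :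
    Polynomial.C (root R n a b) ∣ g - polyAct R n (Equiv.swap a b) g := by
  induction g using Polynomial.induction_on with
  | C f =>
    rw [polyAct_C, ← Polynomial.C_sub]
    exact map_dvd Polynomial.C (root_dvd R n f)
  | add p q hp hq =>
    rw [map_add]
    convert dvd_add hp hq using 1
    ring
  | monomial k f h =>
    rw [pow_succ, ← mul_assoc, map_mul, polyAct_X]
    have hX : Polynomial.C (root R n a b) ∣ Polynomial.C (eps R n (Equiv.swap a b 0)) := by
      have := root_dvd_eps_sub R n a b 0
      rw [eps_zero, zero_sub, dvd_neg] at this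
      exact map_dvd Polynomial.C this
    convert dvd_add (h.mul_right Polynomial.X)
      (hX.mul_left (polyAct R n (Equiv.swap a b) (Polynomial.C f * Polynomial.X ^ k))) using 1
    ring

end Evaluation

/-! ### The dual consists of the polynomials of degree at most `n`. -/

section DualModule

variable (R : Type*) [CommRing R] (n : ℕ)

lemma scalar_mem_D (f : S R n) : scalar R n f ∈ D R n :=
  Subring.subset_closure (Or.inl ⟨f, rfl⟩)

lemma demazure_mem_D {a b : Fin (n + 1)} (h : a ≠ b) : demazure R n h ∈ D R n :=
  Subring.subset_closure (Or.inr ⟨a, b, h, rfl⟩)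

lemma delta_swap_eq {a b : Fin (n + 1)} (h : a ≠ b) :
    (SkewMonoidAlgebra.single (Equiv.swap a b) 1 : QW R n) =
      1 - scalar R n (root R n a b) * demazure R n h := by
  rw [root_mul_demazure, sub_sub_cancel]

lemma delta_mem_D (w : W n) : (SkewMonoidAlgebra.single w 1 : QW R n) ∈ D R n := by
  induction w using Equiv.Perm.swap_induction_on with
  | one => exact one_mem _
  | swap_mul f a b h ih =>
    have : (SkewMonoidAlgebra.single (Equiv.swap a b * f) 1 : QW R n) =
        SkewMonoidAlgebra.single (Equiv.swap a b) 1 * SkewMonoidAlgebra.single f 1 := by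
      rw [SkewMonoidAlgebra.single_mul_single, smul_one, mul_one]
    rw [this, delta_swap_eq R n h]
    exact mul_mem (sub_mem (one_mem _) (mul_mem (scalar_mem_D R n _) (demazure_mem_D R n h))) ih

/-- Moving the reflection onto the functional replaces `g` by `g - α g'`, with `g'` its divided
difference. The hypothesis must therefore cover all polynomials, so as to apply to `g'` too. -/
lemma pairing_ev_demazure_mul {a b : Fin (n + 1)} (h : a ≠ b) (d : QW R n)
    (hd : ∀ g, pairing R n (ev R n g) (proj R n d) ∈ (algebraMap (S R n) (Q R n)).range)
    (g : Polynomial (S R n)) :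
    pairing R n (ev R n g) (proj R n (demazure R n h * d)) ∈
      (algebraMap (S R n) (Q R n)).range := by
  obtain ⟨g', hg'⟩ := root_dvd_sub_polyAct R n a b g
  obtain ⟨x, hx⟩ := hd g
  obtain ⟨y, hy⟩ := hd g'
  obtain ⟨e, he⟩ := root_dvd R n (a := a) (b := b) x
  set s := Equiv.swap a b with hs
  have hg : ev R n (polyAct R n s g) = ev R n g + scalar R n (root R n a b) • ev R n (-g') := by
    rw [scalar_smul_ev, ← ev_add]
    congr 1
    linear_combination -hg'
  have hneg : pairing R n (ev R n (-g')) (proj R n d) = algebraMap _ (Q R n) (-y) := by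
    have h0 := pairing_add R n (ev R n g') (ev R n (-g')) (proj R n d)
    have h1 : pairing R n (ev R n g' + ev R n (-g')) (proj R n d) = 0 := by
      rw [← ev_add, add_neg_cancel]
      have h2 : ev R n 0 = scalar R n 0 • ev R n 0 := by
        rw [scalar_smul_ev, mul_zero]
      rw [h2, pairing_scalar, map_zero, zero_mul]
    rw [map_neg, hy]
    exact eq_neg_of_add_eq_zero_right (h0.symm.trans h1)
  have hss : (SkewMonoidAlgebra.single s⁻¹ 1 : QW R n) * (SkewMonoidAlgebra.single s 1 * d) = d := by
    rw [← mul_assoc, SkewMonoidAlgebra.single_mul_single, smul_one, mul_one, inv_mul_cancel,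
      ← SkewMonoidAlgebra.one_def, one_mul]
  have hinv : (SkewMonoidAlgebra.single s 1 : QW R n) • ev R n (polyAct R n s g) = ev R n g := by
    rw [← delta_smul_ev, ← mul_smul, SkewMonoidAlgebra.single_mul_single, smul_one, mul_one,
      hs, Equiv.swap_mul_self, ← SkewMonoidAlgebra.one_def, one_smul]
  have hsd : pairing R n (ev R n g) (proj R n (SkewMonoidAlgebra.single s 1 * d)) =
      algebraMap _ (Q R n) (actS R n s (x - root R n a b * y)) := by
    rw [← hinv, pairing_delta, hss, hg, pairing_add, pairing_scalar, hneg, ← hx, ← map_mul,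
      ← map_add, smul_algebraMap_eq]
    congr 2
    ring
  have hs' : actS R n s (root R n a b) = -root R n a b := by
    rw [actS_root, hs, Equiv.swap_apply_left, Equiv.swap_apply_right]
    unfold root; ring
  have hroot : algebraMap (S R n) (Q R n) (root R n a b) *
      pairing R n (ev R n g) (proj R n (demazure R n h * d)) =
      algebraMap (S R n) (Q R n) (root R n a b * (e - actS R n s y)) := by
    rw [← pairing_proj_scalar, ← mul_assoc, root_mul_demazure, sub_mul, one_mul, map_sub,
      map_sub, hsd, ← hx, ← map_sub]
    congr 1
    rw [map_sub, map_mul, hs']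
    linear_combination he
  refine ⟨e - actS R n s y, ?_⟩
  have h3 := congrArg (fun t => invRoot R n h * t) hroot
  simp only [map_mul, ← mul_assoc, invRoot_mul, one_mul] at h3
  exact h3.symm

lemma pairing_ev_mem (d : QW R n) (hd : d ∈ D R n) (g : Polynomial (S R n)) :
    pairing R n (ev R n g) (proj R n d) ∈ (algebraMap (S R n) (Q R n)).range := by
  -- Integrality against all `g` is stable under left multiplication by `D`; the claim is the case
  -- `d' = 1`.
  suffices h : ∀ d' : QW R n,
      (∀ g, pairing R n (ev R n g) (proj R n d') ∈ (algebraMap (S R n) (Q R n)).range) →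
      ∀ g, pairing R n (ev R n g) (proj R n (d * d')) ∈ (algebraMap (S R n) (Q R n)).range by
    have := h 1 (fun g => by
      rw [SkewMonoidAlgebra.one_def, proj_single, pairing_single, one_mul]
      exact ⟨_, rfl⟩) g
    rwa [mul_one] at this
  clear g
  induction hd using Subring.closure_induction with
  | mem x hx =>
    intro d' hd' g
    rcases hx with ⟨f, rfl⟩ | ⟨a, b, h, rfl⟩
    · rw [pairing_proj_scalar]
      exact mul_mem ⟨f, rfl⟩ (hd' g)
    · exact pairing_ev_demazure_mul R n h d' hd' g
  | zero => intro d' _ g; rw [zero_mul, map_zero, map_zero]; exact zero_mem _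
  | one => intro d' hd'; simpa only [one_mul] using hd'
  | add x y _ _ hx hy =>
    intro d' hd' g
    rw [add_mul, map_add, map_add]
    exact add_mem (hx d' hd' g) (hy d' hd' g)
  | neg x _ hx =>
    intro d' hd' g
    rw [neg_mul, map_neg, map_neg]
    exact neg_mem (hx d' hd' g)
  | mul x y _ _ hx hy =>
    intro d' hd'
    simpa only [mul_assoc] using hx _ (hy d' hd')

lemma ev_mem (g : Polynomial (S R n)) : ev R n g ∈ DPDual R n := by
  rintro _ ⟨d, hd, rfl⟩
  exact pairing_ev_mem R n d hd g

lemma demazure_smul_mem {a b : Fin (n + 1)} (h : a ≠ b) {z : QDual R n} (hz : z ∈ DPDual R n) :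
    demazure R n h • z ∈ DPDual R n :=
  (DPDual R n).smul_mem ⟨_, demazure_mem_D R n h⟩ hz

lemma sub_mem_DPDual {z z' : QDual R n} (hz : z ∈ DPDual R n) (hz' : z' ∈ DPDual R n) :
    z - z' ∈ DPDual R n :=
  (DPDual R n).sub_mem hz hz'

lemma exists_apply_eq_of_mem {z : QDual R n} (hz : z ∈ DPDual R n) (v : W n ⧸ WP n) :
    ∃ f, algebraMap (S R n) (Q R n) f = z v := by
  induction v using QuotientGroup.induction_on with
  | H w =>
    have h := hz _ ⟨_, delta_mem_D R n w, rfl⟩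
    rw [proj_single, pairing_single, one_mul] at h
    exact h

/-- Each Demazure operator moves the first nonzero value one point down and divides it by one root.
Undoing these steps collects the factors one at a time, so no coprimality of roots is needed. -/
lemma exists_apply_eq_mul_prod (k : ℕ) : ∀ (a : Fin (n + 1)), a.val = k → ∀ z ∈ DPDual R n,
    (∀ v, (pos n v).val < k → z v = 0) → ∀ v, pos n v = a →
    ∃ c, z v = algebraMap (S R n) (Q R n)
      (c * ∏ b ∈ Finset.univ.filter (fun b : Fin (n + 1) => b.val < k),
        (eps R n a - eps R n b)) := by
  induction k with
  | zero =>
    intro a _ z hz _ v _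
    obtain ⟨f, hf⟩ := exists_apply_eq_of_mem R n hz v
    exact ⟨f, by simp [hf]⟩
  | succ k ih =>
    intro a ha z hz h0 v hv
    have hk : k < n + 1 := by omega
    set b : Fin (n + 1) := ⟨k, hk⟩ with hb
    have hba : b ≠ a := by
      intro e
      have : k = a.val := congrArg Fin.val e
      omega
    set s : W n := Equiv.swap b a with hs
    have hdem : ∀ u, (demazure R n hba • z) u = invRoot R n hba * (z u - s • z (s⁻¹ • u)) := by
      intro u
      have h1 : demazure R n hba = SkewMonoidAlgebra.single 1 (invRoot R n hba) *
        (1 - SkewMonoidAlgebra.single (Equiv.swap b a) 1) := rfl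
      rw [h1, mul_smul, sub_smul, one_smul, single_smul_apply, inv_one, one_smul, one_smul,
        QDual.sub_apply, single_smul_apply, one_mul]
    -- The reflection exchanges the neighbours `b` and `a`, so the new functional still vanishes
    -- below `b`.
    have hlow : ∀ c : Fin (n + 1), c.val < k → s c = c := fun c hc =>
      Equiv.swap_apply_of_ne_of_ne (fun e => by rw [e] at hc; exact lt_irrefl _ hc)
        (fun e => by rw [e] at hc; omega)
    have hsinv : s⁻¹ = s := Equiv.swap_inv _ _
    have hposv : pos n (s • v) = b := by rw [pos_smul, hv, hs, Equiv.swap_apply_right]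
    obtain ⟨c, hc⟩ := ih b rfl _ (demazure_smul_mem R n hba hz) (by
      intro u hu
      rw [hdem, h0 u (by omega), h0 (s⁻¹ • u) (by rw [pos_smul, hsinv, hlow _ hu]; omega),
        smul_zero, sub_zero, mul_zero]) (s • v) hposv
    rw [hdem, inv_smul_smul, h0 (s • v) (by rw [hposv]; exact Nat.lt_succ_self k), zero_sub] at hc
    have h3 : -(s • z v) = algebraMap (S R n) (Q R n) (root R n b a *
        (c * ∏ d ∈ Finset.univ.filter (fun d : Fin (n + 1) => d.val < k),
          (eps R n b - eps R n d))) := by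
      rw [map_mul, ← hc, ← mul_assoc, mul_comm (algebraMap _ _ _), invRoot_mul, one_mul]
    have h4 : z v = -(s • algebraMap (S R n) (Q R n) (root R n b a *
        (c * ∏ d ∈ Finset.univ.filter (fun d : Fin (n + 1) => d.val < k),
          (eps R n b - eps R n d)))) := by
      rw [← h3, smul_neg, neg_neg, ← mul_smul, hs, Equiv.swap_mul_self, one_smul]
    have hprod : actS R n s (∏ d ∈ Finset.univ.filter (fun d : Fin (n + 1) => d.val < k),
          (eps R n b - eps R n d)) =
        ∏ d ∈ Finset.univ.filter (fun d : Fin (n + 1) => d.val < k),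
          (eps R n a - eps R n d) := by
      rw [map_prod]
      refine Finset.prod_congr rfl fun d hd => ?_
      have : actS R n s (root R n b d) = root R n a d := by
        rw [actS_root, hlow d (Finset.mem_filter.1 hd).2, hs, Equiv.swap_apply_left]
      exact this
    have hins : Finset.univ.filter (fun d : Fin (n + 1) => d.val < k + 1) =
        insert b (Finset.univ.filter (fun d : Fin (n + 1) => d.val < k)) := by
      ext d
      simp only [Finset.mem_filter, Finset.mem_univ, true_and, Finset.mem_insert, Fin.ext_iff, hb]
      omega
    refine ⟨-actS R n s c, ?_⟩
    rw [h4, smul_algebraMap_eq, map_mul (actS R n s), map_mul (actS R n s), hprod, ← map_neg, hins,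
      Finset.prod_insert (by simp [hb]), actS_root, hs, Equiv.swap_apply_left,
      Equiv.swap_apply_right]
    congr 1
    unfold root
    ring

/-- The elements of the dual are given by polynomials of degree at most `n`. -/
lemma exists_ev_eq [Nontrivial R] {z : QDual R n} (hz : z ∈ DPDual R n) :
    ∃ g : Polynomial (S R n), g.degree < (n + 1 : ℕ) ∧ ev R n g = z := by
  suffices h : ∀ k ≤ n + 1, ∃ g : Polynomial (S R n), g.degree < (n + 1 : ℕ) ∧
      ∀ v, (pos n v).val < k → (z - ev R n g) v = 0 by
    obtain ⟨g, hg, h0⟩ := h (n + 1) le_rfl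
    exact ⟨g, hg, funext fun v => (sub_eq_zero.1 (h0 v (pos n v).isLt)).symm⟩
  intro k
  induction k with
  | zero => exact fun _ => ⟨0, by simp, fun v hv => absurd hv (Nat.not_lt_zero _)⟩
  | succ k ih =>
    intro hk
    obtain ⟨g, hg, h0⟩ := ih (by omega)
    obtain ⟨v₀, hv₀⟩ := pos_surjective n ⟨k, by omega⟩
    obtain ⟨c, hc⟩ := exists_apply_eq_mul_prod R n k ⟨k, by omega⟩ rfl _
      (sub_mem_DPDual R n hz (ev_mem R n g)) h0 v₀ hv₀
    -- The Newton polynomial: zero at the first `k` points, and at the next one equal to the product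
    -- that divides the remaining error.
    set P : Polynomial (S R n) :=
      ∏ b ∈ Finset.univ.filter (fun b : Fin (n + 1) => b.val < k),
        (Polynomial.X - Polynomial.C (eps R n b)) with hP
    have hcard : (Finset.univ.filter (fun b : Fin (n + 1) => b.val < k)).card ≤ k := by
      rw [Fin.card_filter_val_lt]
      exact min_le_right _ _
    have hdeg : (Polynomial.C c * P).degree < (n + 1 : ℕ) := by
      refine lt_of_le_of_lt (Polynomial.degree_le_of_natDegree_le
        ((Polynomial.natDegree_C_mul_le _ _).trans ((Polynomial.natDegree_prod_le _ _).trans ?_)))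
        (Nat.cast_lt.2 hk)
      refine (Finset.sum_le_card_nsmul _ _ 1 fun b _ => ?_).trans (by simpa using hcard)
      exact Polynomial.natDegree_X_sub_C_le _
    refine ⟨g + Polynomial.C c * P,
      lt_of_le_of_lt (Polynomial.degree_add_le _ _) (max_lt hg hdeg), fun v hv => ?_⟩
    rw [ev_add, ← sub_sub, QDual.sub_apply, ev_apply, Polynomial.eval_mul, Polynomial.eval_C, hP,
      Polynomial.eval_prod]
    simp only [Polynomial.eval_sub, Polynomial.eval_X, Polynomial.eval_C]
    rcases Nat.lt_succ_iff_lt_or_eq.1 hv with h | h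
    · rw [h0 v h, Finset.prod_eq_zero (i := pos n v) (by simpa using h) (sub_self _), mul_zero,
        map_zero, sub_zero]
    · have hvv : v = v₀ := pos_injective n (by rw [hv₀]; exact Fin.ext h)
      rw [hvv, hc, hv₀, sub_self]

lemma ev_injOn [IsDomain R] {g h : Polynomial (S R n)} (hg : g.degree < (n + 1 : ℕ))
    (hh : h.degree < (n + 1 : ℕ)) (e : ev R n g = ev R n h) : g = h := by
  refine Polynomial.eq_of_degrees_lt_of_eval_index_eq (v := eps R n) Finset.univ
    (eps_injective R n).injOn (by simpa using hg) (by simpa using hh) fun a _ => ?_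
  obtain ⟨v, rfl⟩ := pos_surjective n a
  exact algebraMap_injective R n (congrFun e v)

end DualModule

end NilHecke

/-! ### Idempotent matrices. -/

section MatrixAlgebra

variable {K : Type*} [Field K] {m : ℕ}

/-- Each use of `A = A * A` clears one more superdiagonal. -/
lemma Matrix.eq_zero_of_idempotent_of_strictUpper (A : Matrix (Fin m) (Fin m) K) (hA : A * A = A)
    (h : ∀ i j, j ≤ i → A i j = 0) : A = 0 := by
  have key : ∀ d : ℕ, ∀ i j : Fin m, j.val < i.val + d → A i j = 0 := by
    intro d
    induction d with
    | zero => exact fun i j hij => h i j (Fin.le_def.2 (by omega))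
    | succ d ih =>
      intro i j hij
      rw [← hA, Matrix.mul_apply]
      refine Finset.sum_eq_zero fun k _ => ?_
      by_cases hk : k ≤ i
      · rw [h i k hk, zero_mul]
      · rw [ih k j (by rw [Fin.le_def] at hk; omega), mul_zero]
  ext i j
  exact key (j.val + 1) i j (by omega)

/-- The diagonal entry is itself idempotent, so `A` or `1 - A` is strictly upper triangular. -/
lemma Matrix.eq_zero_or_one_of_idempotent_of_upper (A : Matrix (Fin (m + 1)) (Fin (m + 1)) K)
    (hA : A * A = A) (c : K) (hlow : ∀ i j, j < i → A i j = 0) (hdiag : ∀ i, A i i = c) :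
    A = 0 ∨ A = 1 := by
  have hc : c * c = c := by
    have h := congrFun (congrFun hA 0) 0
    rw [Matrix.mul_apply, Finset.sum_eq_single 0, hdiag] at h
    · exact h
    · intro k _ hk
      rw [hlow k 0 (Fin.pos_iff_ne_zero.2 hk), mul_zero]
    · simp
  rcases IsIdempotentElem.iff_eq_zero_or_one.1 hc with h0 | h1
  · left
    refine A.eq_zero_of_idempotent_of_strictUpper hA fun i j hij => ?_
    rcases hij.lt_or_eq with h | rfl
    · exact hlow i j h
    · rw [hdiag, h0]
  · right
    have h := (1 - A).eq_zero_of_idempotent_of_strictUpper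
      (by rw [mul_sub, sub_mul, sub_mul, hA]; simp) fun i j hij => by
        rcases hij.lt_or_eq with h | rfl
        · rw [Matrix.sub_apply, hlow i j h, Matrix.one_apply_ne h.ne', sub_zero]
        · rw [Matrix.sub_apply, hdiag, Matrix.one_apply_eq, h1, sub_self]
    exact (sub_eq_zero.1 h).symm

/-- By `B = B * B` the entries lie in every power of the kernel of `π`, and these powers meet in
zero by Krull's theorem. -/
lemma Matrix.eq_zero_of_idempotent_of_map_eq_zero {A : Type*} [CommRing A] [IsDomain A]
    [IsNoetherianRing A] (π : A →+* K) (B : Matrix (Fin m) (Fin m) A) (hB : B * B = B)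
    (h : B.map π = 0) : B = 0 := by
  have key : ∀ d : ℕ, ∀ i j, B i j ∈ RingHom.ker π ^ d := by
    intro d
    induction d with
    | zero => simp
    | succ d ih =>
      intro i j
      rw [← hB, Matrix.mul_apply, pow_succ]
      exact Ideal.sum_mem _ fun k _ => Ideal.mul_mem_mul (ih i k)
        (congrFun (congrFun h k) j)
  ext i j
  have hmem : B i j ∈ (⨅ d, RingHom.ker π ^ d : Ideal A) :=
    (Submodule.mem_iInf _).2 fun d => key d i j
  rwa [Ideal.iInf_pow_eq_bot_of_isDomain _ (RingHom.ker_ne_top π), Ideal.mem_bot] at hmem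

lemma Matrix.eq_zero_or_one_of_idempotent_of_map {A : Type*} [CommRing A] [IsDomain A]
    [IsNoetherianRing A] (π : A →+* K) (B : Matrix (Fin m) (Fin m) A) (hB : B * B = B)
    (h : B.map π = 0 ∨ B.map π = 1) : B = 0 ∨ B = 1 := by
  rcases h with h | h
  · exact Or.inl (B.eq_zero_of_idempotent_of_map_eq_zero π hB h)
  · right
    refine (sub_eq_zero.1 ((1 - B).eq_zero_of_idempotent_of_map_eq_zero π
      (by rw [mul_sub, sub_mul, sub_mul, hB]; simp) ?_)).symm
    rw [Matrix.map_sub _ (map_sub π), h, Matrix.map_one _ (map_zero π) (map_one π), sub_self]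

end MatrixAlgebra

/-! ### Binomial coefficients modulo `p`. -/

section Choose

variable {K : Type*} [Field K] {p r n : ℕ} [CharP K p]

lemma choose_prime_pow_cast_eq_zero (hp : p.Prime) {k : ℕ} (h0 : k ≠ 0) (h1 : k ≠ p ^ r) :
    ((p ^ r).choose k : K) = 0 :=
  (CharP.cast_eq_zero_iff K p _).2 (hp.dvd_choose_pow h0 h1)

/-- By Pascal's rule, neighbours in row `p ^ r - 1` add up to an inner entry of row `p ^ r`, which
vanishes. -/
lemma choose_prime_pow_sub_one_cast (hp : p.Prime) (hn : n + 1 = p ^ r) {l : ℕ} (hl : l ≤ n) :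
    (n.choose l : K) = (-1) ^ l := by
  induction l with
  | zero => simp
  | succ l ih =>
    have h := choose_prime_pow_cast_eq_zero (K := K) (r := r) hp (Nat.succ_ne_zero l)
      (by rw [← hn]; omega)
    rw [← hn, Nat.choose_succ_succ, Nat.cast_add, ih (by omega)] at h
    rw [pow_succ]
    linear_combination h

end Choose

namespace NilHecke

open Polynomial

/-! ### The defining polynomial and the point classes. -/

section PointClasses

variable (R : Type*) [CommRing R] (n : ℕ)

/-- The polynomial `∏ (X - (ε_a - ε_0))`. -/
def fundPoly : (S R n)[X] := ∏ a : Fin (n + 1), (X - C (eps R n a))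

lemma fundPoly_monic : (fundPoly R n).Monic := monic_prod_X_sub_C _ _

lemma fundPoly_natDegree [Nontrivial R] : (fundPoly R n).natDegree = n + 1 := by
  simp [fundPoly]

lemma eval_fundPoly (a : Fin (n + 1)) : (fundPoly R n).eval (eps R n a) = 0 := by
  rw [fundPoly, eval_prod]
  exact Finset.prod_eq_zero (Finset.mem_univ a) (by simp)

lemma polyAct_fundPoly (w : W n) : polyAct R n w (fundPoly R n) = fundPoly R n := by
  rw [fundPoly, map_prod, ← Equiv.prod_comp w (fun a => X - C (eps R n a))]
  refine Finset.prod_congr rfl fun a _ => ?_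
  rw [map_sub, polyAct_X, polyAct_C, actS_eps, C_sub]
  ring

lemma fundPoly_dvd [IsDomain R] (g : (S R n)[X]) (h : ∀ a, g.eval (eps R n a) = 0) :
    fundPoly R n ∣ g := by
  have hf := fundPoly_monic R n
  rw [← modByMonic_eq_zero_iff_dvd hf]
  refine eq_zero_of_degree_lt_of_eval_index_eq_zero (v := eps R n) Finset.univ
    (eps_injective R n).injOn ?_ fun a _ => ?_
  · refine lt_of_lt_of_le (degree_modByMonic_lt g hf) ?_
    rw [degree_eq_natDegree hf.ne_zero, fundPoly_natDegree]
    simp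
  · have := congrArg (eval (eps R n a)) (modByMonic_add_div g (fundPoly R n))
    rwa [eval_add, eval_mul, eval_fundPoly, zero_mul, add_zero, h] at this

/-- The polynomial `∏ (X - (ε_b - ε_0))`, with the factor of the index `a` left out: the class of
a point. -/
def pointPoly (a : Fin (n + 1)) : (S R n)[X] := fundPoly R n /ₘ (X - C (eps R n a))

lemma mul_pointPoly (a : Fin (n + 1)) :
    (X - C (eps R n a)) * pointPoly R n a = fundPoly R n :=
  mul_divByMonic_eq_iff_isRoot.2 (eval_fundPoly R n a)

lemma pointPoly_degree_lt [Nontrivial R] (a : Fin (n + 1)) :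
    (pointPoly R n a).degree < (n + 1 : ℕ) := by
  rw [← fundPoly_natDegree R n, ← degree_eq_natDegree (fundPoly_monic R n).ne_zero]
  refine degree_divByMonic_lt _ _ (fundPoly_monic R n).ne_zero ?_
  rw [degree_X_sub_C]
  exact zero_lt_one

lemma polyAct_pointPoly (w : W n) :
    polyAct R n w (pointPoly R n 0) = pointPoly R n (w 0) := by
  have h := congrArg (polyAct R n w) (mul_pointPoly R n 0)
  have hX : polyAct R n w (X - C (eps R n 0)) = X - C (eps R n (w 0)) := by
    rw [map_sub, polyAct_X, polyAct_C, eps_zero, map_zero (actS R n w), C_0, sub_zero]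
  rw [polyAct_fundPoly, map_mul, hX, ← mul_pointPoly R n (w 0)] at h
  exact (monic_X_sub_C _).isRegular.left h

/-- The coefficient of `pointPoly R n a` at `X ^ m` as a polynomial in `ε_a - ε_0`. -/
def pointCoeff (m : ℕ) : (S R n)[X] :=
  ∑ i ∈ Finset.Icc (m + 1) (n + 1), C ((fundPoly R n).coeff i) * X ^ (i - (m + 1))

/-- Synthetic division: one polynomial gives the coefficient for all points `a` at once. -/
lemma eval_pointCoeff [Nontrivial R] (m : ℕ) (a : Fin (n + 1)) :
    (pointCoeff R n m).eval (eps R n a) = (pointPoly R n a).coeff m := by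
  rw [pointPoly, coeff_divByMonic_X_sub_C, fundPoly_natDegree, pointCoeff, eval_finsetSum]
  refine Finset.sum_congr rfl fun i _ => ?_
  rw [Polynomial.eval_mul, eval_C, eval_pow, eval_X, mul_comm]

lemma polyAct_degree_lt (w : W n) (g : (S R n)[X]) (hg : g.degree < (n + 1 : ℕ)) :
    (polyAct R n w g).degree < (n + 1 : ℕ) := by
  have h : polyAct R n w g = (g.map (actS R n w : S R n →+* S R n)).comp
      (X - C (eps R n (w 0))) := by
    rw [comp, eval₂_map]; rfl
  by_cases h0 : g = 0
  · rw [h0, map_zero]; simp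
  refine lt_of_le_of_lt (degree_le_of_natDegree_le (n := n) ?_) (Nat.cast_lt.2 n.lt_succ_self)
  rw [h]
  refine natDegree_comp_le.trans ?_
  have h1 : g.natDegree ≤ n := Nat.lt_succ_iff.1 ((natDegree_lt_iff_degree_lt h0).2 hg)
  calc _ ≤ n * 1 := Nat.mul_le_mul (natDegree_map_le.trans h1) (natDegree_X_sub_C_le _)
    _ = n := mul_one n

end PointClasses

/-! ### Reduction modulo the roots. -/

section Reduction

variable (R : Type*) [CommRing R] (n : ℕ) {K : Type*} [Field K] (π : S R n →+* K)

lemma map_eps (hπ : ∀ i, π (MvPolynomial.X i) = 0) (a : Fin (n + 1)) : π (eps R n a) = 0 := by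
  rw [eps, map_neg, map_sum, Finset.sum_eq_zero fun i _ => hπ i, neg_zero]

lemma map_fundPoly (hπ : ∀ i, π (MvPolynomial.X i) = 0) :
    (fundPoly R n).map π = X ^ (n + 1) := by
  rw [fundPoly, Polynomial.map_prod]
  simp [map_eps R n π hπ]

lemma map_pointCoeff (hπ : ∀ i, π (MvPolynomial.X i) = 0) {m : ℕ} (hm : m ≤ n) :
    (pointCoeff R n m).map π = X ^ (n - m) := by
  have h : ∀ i, π ((fundPoly R n).coeff i) = if i = n + 1 then 1 else 0 := by
    intro i
    rw [← coeff_map, map_fundPoly R n π hπ, coeff_X_pow]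
  rw [pointCoeff, Polynomial.map_sum, Finset.sum_eq_single (n + 1)]
  · simp [h]
  · intro i _ hi
    simp [h, hi]
  · simp [hm]

lemma map_hasseDeriv_fundPoly {p r : ℕ} [CharP K p] (hp : p.Prime) (hn : n + 1 = p ^ r)
    (hπ : ∀ i, π (MvPolynomial.X i) = 0) {k : ℕ} (h0 : k ≠ 0) (h1 : k < n + 1) :
    (hasseDeriv k (fundPoly R n)).map π = 0 := by
  have : (hasseDeriv k (fundPoly R n)).map π = hasseDeriv k ((fundPoly R n).map π) := by
    ext i
    simp [hasseDeriv_coeff]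
  rw [this, map_fundPoly R n π hπ, X_pow_eq_monomial, hasseDeriv_monomial, hn,
    choose_prime_pow_cast_eq_zero hp h0 (by omega)]
  simp

end Reduction

/-! ### Invariants of `W_P` and their translates. -/

section Invariants

variable (R : Type*) [CommRing R] (n : ℕ)

lemma taylor_fundPoly (w : W n) : taylor (eps R n (w 0)) (fundPoly R n) =
    X * ∏ i : Fin n, (X + C (eps R n (w 0) - eps R n (w i.succ))) := by
  have h : taylor (eps R n (w 0)) (fundPoly R n) =
      ∏ a : Fin (n + 1), (X + C (eps R n (w 0) - eps R n a)) := by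
    rw [← taylorAlgHom_apply, fundPoly, map_prod]
    refine Finset.prod_congr rfl fun a _ => ?_
    simp
    ring
  rw [h, ← Equiv.prod_comp w, Fin.prod_univ_succ]
  simp

/-- Both sides are a Taylor coefficient of `fundPoly` at one of its roots: the other factors have
constant terms `ε_{w 0} - ε_{w (i+1)}`, the translates of the coordinates. -/
lemma eval_hasseDeriv_fundPoly (w : W n) (i : Fin n) :
    (hasseDeriv (n - i) (fundPoly R n)).eval (eps R n (w 0)) =
      actS R n w (coordEquiv R n (MvPolynomial.esymm (Fin n) R (i + 1))) := by
  have hi := i.isLt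
  rw [← taylor_coeff, taylor_fundPoly, show n - i.val = (n - i.val - 1) + 1 by omega, coeff_X_mul,
    Finset.prod_X_add_C_coeff _ _ (by simp; omega), Finset.card_univ, Fintype.card_fin,
    show n - (n - i.val - 1) = i.val + 1 by omega, MvPolynomial.esymm, map_sum, map_sum]
  refine Finset.sum_congr rfl fun t _ => ?_
  rw [map_prod, map_prod]
  refine Finset.prod_congr rfl fun j _ => ?_
  rw [coordEquiv_X, map_neg, actS_eps, neg_sub]

/-- The stabilizer of `0` permutes the coordinates `ε_0 - ε_{i+1}`, so its invariants are the
symmetric polynomials. -/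
lemma actS_coordEquiv (σ : Equiv.Perm (Fin n)) (A : MvPolynomial (Fin n) R) :
    actS R n (Equiv.Perm.decomposeFin.symm (0, σ)) (coordEquiv R n A) =
      coordEquiv R n (MvPolynomial.rename σ A) := by
  have : (actS R n (Equiv.Perm.decomposeFin.symm (0, σ))).comp (coordEquiv R n).toAlgHom =
      (coordEquiv R n).toAlgHom.comp (MvPolynomial.rename σ) := by
    ext1 i
    rw [AlgHom.comp_apply, AlgHom.comp_apply, AlgEquiv.toAlgHom_apply, AlgEquiv.toAlgHom_apply,
      MvPolynomial.rename_X, coordEquiv_X, coordEquiv_X, map_neg, actS_eps]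
    simp [eps_zero]
  exact DFunLike.congr_fun this A

/-- The translates of an invariant of `W_P` are the values of one polynomial, which is constant
modulo `p` and the roots if `n + 1` is a power of `p`. -/
lemma exists_eval_eq_actS {K : Type*} [Field K] (π : S R n →+* K)
    {p r : ℕ} [CharP K p] (hp : p.Prime) (hn : n + 1 = p ^ r)
    (hπ : ∀ i, π (MvPolynomial.X i) = 0) (f : S R n) (hf : ∀ w : W n, w 0 = 0 → actS R n w f = f) :
    ∃ (B : (S R n)[X]) (c : K), (∀ w : W n, B.eval (eps R n (w 0)) = actS R n w f) ∧
      B.map π = C c := by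
  obtain ⟨A, rfl⟩ := (coordEquiv R n).surjective f
  have hA : A.IsSymmetric := fun σ => (coordEquiv R n).injective (by
    rw [← actS_coordEquiv, hf _ (by simp)])
  obtain ⟨P, hP⟩ := MvPolynomial.esymmAlgHom_surjective (σ := Fin n) R (n := n) (by simp)
    ⟨A, (MvPolynomial.mem_symmetricSubalgebra A).2 hA⟩
  have hPA : MvPolynomial.aeval (fun i : Fin n => MvPolynomial.esymm (Fin n) R (i + 1)) P = A := by
    rw [← MvPolynomial.esymmAlgHom_apply, hP]
  -- Hasse derivatives replace the elementary symmetric polynomials in `P`. Their orders lie between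
  -- `1` and `n`, so they reduce to zero and only the constant term of `P` survives.
  refine ⟨MvPolynomial.aeval (fun i : Fin n => hasseDeriv (n - i) (fundPoly R n)) P,
    MvPolynomial.eval₂Hom (π.comp MvPolynomial.C) 0 P, fun w => ?_, ?_⟩
  · have : ((Polynomial.aeval (eps R n (w 0))).restrictScalars R).comp
        (MvPolynomial.aeval fun i : Fin n => hasseDeriv (n - i) (fundPoly R n)) =
        (actS R n w).comp ((coordEquiv R n).toAlgHom.comp
          (MvPolynomial.aeval fun i : Fin n => MvPolynomial.esymm (Fin n) R (i + 1))) := by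
      ext1 i
      rw [AlgHom.comp_apply, AlgHom.comp_apply, AlgHom.comp_apply, AlgEquiv.toAlgHom_apply,
        AlgHom.restrictScalars_apply, MvPolynomial.aeval_X, MvPolynomial.aeval_X, ← eval_hasseDeriv_fundPoly,
        coe_aeval_eq_eval]
    rw [← hPA, ← coe_aeval_eq_eval]
    exact DFunLike.congr_fun this P
  · have : (mapRingHom π).comp ((MvPolynomial.aeval
        (fun i : Fin n => hasseDeriv (n - i) (fundPoly R n)) :
          MvPolynomial (Fin n) R →ₐ[R] (S R n)[X]) : MvPolynomial (Fin n) R →+* (S R n)[X]) =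
        (C : K →+* K[X]).comp (MvPolynomial.eval₂Hom (π.comp MvPolynomial.C) 0) := by
      refine MvPolynomial.ringHom_ext (fun x => ?_) fun i => ?_
      · simp [MvPolynomial.algebraMap_eq, Polynomial.algebraMap_apply]
      · have := i.isLt
        have h := map_hasseDeriv_fundPoly R n π hp hn hπ (k := n - i) (by omega) (by omega)
        simp [h]
    exact DFunLike.congr_fun this P

end Invariants

open Polynomial
open scoped Classical

/-! ### Endomorphisms of the dual as matrices. -/

section Endomorphisms

variable (R : Type*) [CommRing R] (n : ℕ)

/-- The map from polynomials to elements of the dual. -/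
def evHom : (S R n)[X] →+ DPDual R n where
  toFun g := ⟨ev R n g, ev_mem R n g⟩
  map_zero' := Subtype.ext (funext fun v => by simp [ev_apply, QDual.zero_apply])
  map_add' g h := Subtype.ext (ev_add R n g h)

lemma scalar_smul_evHom (f : S R n) (g : (S R n)[X]) :
    (⟨scalar R n f, scalar_mem_D R n f⟩ : D R n) • evHom R n g = evHom R n (C f * g) :=
  Subtype.ext (scalar_smul_ev R n f g)

lemma delta_smul_evHom (w : W n) (g : (S R n)[X]) :
    (⟨SkewMonoidAlgebra.single w 1, delta_mem_D R n w⟩ : D R n) • evHom R n g =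
      evHom R n (polyAct R n w g) :=
  Subtype.ext (delta_smul_ev R n w g)

lemma exists_evHom_eq [Nontrivial R] (z : DPDual R n) :
    ∃ g : (S R n)[X], g.degree < (n + 1 : ℕ) ∧ evHom R n g = z := by
  obtain ⟨g, hg, h⟩ := exists_ev_eq R n z.2
  exact ⟨g, hg, Subtype.ext h⟩

lemma evHom_injOn [IsDomain R] {g h : (S R n)[X]} (hg : g.degree < (n + 1 : ℕ))
    (hh : h.degree < (n + 1 : ℕ)) (e : evHom R n g = evHom R n h) : g = h :=
  ev_injOn R n hg hh (congrArg Subtype.val e)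

lemma ofFn_toFn {g : (S R n)[X]} (hg : g.degree < (n + 1 : ℕ)) :
    ofFn (n + 1) (toFn (n + 1) g) = g := by
  ext i
  by_cases hi : i < n + 1
  · rw [ofFn_coeff_eq_val_of_lt _ hi]; rfl
  · rw [ofFn_coeff_eq_zero_of_ge _ (not_lt.1 hi), coeff_eq_zero_of_degree_lt]
    exact hg.trans_le (Nat.cast_le.2 (not_lt.1 hi))

lemma ofFn_eq_sum (v : Fin (n + 1) → S R n) :
    ofFn (n + 1) v = ∑ i : Fin (n + 1), C (v i) * X ^ (i : ℕ) := by
  rw [ofFn_eq_sum_monomial]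
  exact Finset.sum_congr rfl fun i _ => C_mul_X_pow_eq_monomial.symm

/-- An endomorphism of the dual is given by a matrix in the basis of powers. -/
lemma exists_matrix [Nontrivial R] (φ : DPDual R n →ₗ[D R n] DPDual R n) :
    ∃ Φ : Matrix (Fin (n + 1)) (Fin (n + 1)) (S R n), ∀ v : Fin (n + 1) → S R n,
      φ (evHom R n (ofFn (n + 1) v)) = evHom R n (ofFn (n + 1) (Φ.mulVec v)) := by
  choose G hG hφ using fun m : Fin (n + 1) => exists_evHom_eq R n (φ (evHom R n (X ^ (m : ℕ))))
  refine ⟨Matrix.of fun l m => (G m).coeff l, fun v => ?_⟩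
  have h : ofFn (n + 1) (Matrix.mulVec (Matrix.of fun l m => (G m).coeff l) v) =
      ∑ m : Fin (n + 1), C (v m) * G m := by
    have h1 : Matrix.mulVec (Matrix.of fun l m : Fin (n + 1) => (G m).coeff l) v =
        ∑ m : Fin (n + 1), v m • toFn (n + 1) (G m) := by
      ext1 l
      rw [Finset.sum_apply, Matrix.mulVec, dotProduct]
      exact Finset.sum_congr rfl fun m _ => mul_comm ((G m).coeff l) (v m)
    rw [h1, map_sum]
    refine Finset.sum_congr rfl fun m _ => ?_
    rw [map_smul, ofFn_toFn R n (hG m), smul_eq_C_mul]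
  rw [h, ofFn_eq_sum, map_sum, map_sum, map_sum]
  refine Finset.sum_congr rfl fun m _ => ?_
  rw [← scalar_smul_evHom, map_smul, ← hφ, scalar_smul_evHom]

variable {R n} {φ : DPDual R n →ₗ[D R n] DPDual R n}
  {Φ : Matrix (Fin (n + 1)) (Fin (n + 1)) (S R n)}

lemma matrix_mul_self [IsDomain R]
    (hΦ : ∀ v, φ (evHom R n (ofFn (n + 1) v)) = evHom R n (ofFn (n + 1) (Φ.mulVec v)))
    (hφ : ∀ z, φ (φ z) = φ z) : Φ * Φ = Φ := by
  refine Matrix.mulVec_injective (funext fun v => ?_)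
  have h := hφ (evHom R n (ofFn (n + 1) v))
  rw [hΦ, hΦ] at h
  have h2 := injective_ofFn _ (evHom_injOn R n (ofFn_degree_lt _) (ofFn_degree_lt _) h)
  rwa [Matrix.mulVec_mulVec] at h2

lemma apply_eq_of_matrix [Nontrivial R]
    (hΦ : ∀ v, φ (evHom R n (ofFn (n + 1) v)) = evHom R n (ofFn (n + 1) (Φ.mulVec v)))
    (h : Φ = 0 ∨ Φ = 1) : (∀ z, φ z = 0) ∨ ∀ z, φ z = z := by
  refine h.imp (fun h z => ?_) fun h z => ?_ <;>
  · obtain ⟨g, hg, rfl⟩ := exists_evHom_eq R n z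
    rw [← ofFn_toFn R n hg, hΦ, h]
    simp

variable [IsDomain R]

lemma polyAct_image_pointPoly
    (hΦ : ∀ v, φ (evHom R n (ofFn (n + 1) v)) = evHom R n (ofFn (n + 1) (Φ.mulVec v)))
    (w : W n) :
    polyAct R n w (ofFn (n + 1) (Φ.mulVec (toFn (n + 1) (pointPoly R n 0)))) =
      ofFn (n + 1) (Φ.mulVec (toFn (n + 1) (pointPoly R n (w 0)))) := by
  refine evHom_injOn R n (polyAct_degree_lt R n w _ (ofFn_degree_lt _)) (ofFn_degree_lt _) ?_
  rw [← delta_smul_evHom, ← hΦ, ← hΦ, ofFn_toFn R n (pointPoly_degree_lt R n _),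
    ofFn_toFn R n (pointPoly_degree_lt R n _), ← map_smul, delta_smul_evHom, polyAct_pointPoly]

/-- The images of the point classes are computed in two ways, by `Φ` and by translating the image of
the class of `0`. Agreement at all `ε_a - ε_0` is a congruence modulo `fundPoly`, which reduces to
one modulo `X ^ (n + 1)`. -/
lemma map_matrix_upper {K : Type*} [Field K] (π : S R n →+* K)
    {p r : ℕ} [CharP K p] (hp : p.Prime) (hn : n + 1 = p ^ r)
    (hπ : ∀ i, π (MvPolynomial.X i) = 0)
    (hΦ : ∀ v, φ (evHom R n (ofFn (n + 1) v)) = evHom R n (ofFn (n + 1) (Φ.mulVec v))) :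
    ∃ c : K, (∀ l m, m < l → Φ.map π l m = 0) ∧ ∀ l, Φ.map π l l = c := by
  set a : Fin (n + 1) → S R n := Φ.mulVec (toFn (n + 1) (pointPoly R n 0)) with ha
  have hact : ∀ w : W n, ofFn (n + 1) (Φ.mulVec (toFn (n + 1) (pointPoly R n (w 0)))) =
      ∑ k : Fin (n + 1), C (actS R n w (a k)) * (X - C (eps R n (w 0))) ^ (k : ℕ) := by
    intro w
    rw [← polyAct_image_pointPoly hΦ, ← ha, ofFn_eq_sum, map_sum]
    refine Finset.sum_congr rfl fun k _ => ?_
    rw [map_mul, map_pow, polyAct_C, polyAct_X]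
  have hinv : ∀ k (w : W n), w 0 = 0 → actS R n w (a k) = a k := by
    intro k w hw
    have h := hact w
    simp only [hw, eps_zero, C_0, sub_zero] at h
    rw [← ofFn_eq_sum R n fun k => actS R n w (a k)] at h
    exact (congrFun (injective_ofFn _ h) k).symm
  choose B c hB hc using fun k => exists_eval_eq_actS R n π hp hn hπ (a k) (hinv k)
  have hcoeff : ∀ l m : Fin (n + 1), π (Φ l m) = ∑ k : Fin (n + 1),
      c k * ((k : ℕ).choose l * ((-1) ^ (k - l : ℕ) * if n - m = (k - l : ℕ) then 1 else 0)) := by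
    intro l m
    -- The variable now stands for `ε_a - ε_0`, and `P` is the difference of the two expressions for
    -- the coefficient of index `l`.
    set P : (S R n)[X] := ∑ m : Fin (n + 1), C (Φ l m) * pointCoeff R n m -
      ∑ k : Fin (n + 1), B k * (C (((k : ℕ).choose l : ℕ) : S R n) * (-X) ^ (k - l : ℕ)) with hP
    have hdvd : fundPoly R n ∣ P := by
      refine fundPoly_dvd R n P fun j => ?_
      have h := congrArg (fun g => g.coeff (l : ℕ)) (hact (Equiv.swap 0 j))
      simp only [Equiv.swap_apply_left] at h
      rw [ofFn_coeff_eq_val_of_lt _ l.isLt, finsetSum_coeff] at h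
      rw [hP, eval_sub, eval_finsetSum, eval_finsetSum, sub_eq_zero]
      refine Eq.trans ?_ (h.trans ?_)
      · refine Finset.sum_congr rfl fun m _ => ?_
        rw [Polynomial.eval_mul, eval_C, eval_pointCoeff]
        rfl
      · refine Finset.sum_congr rfl fun k _ => ?_
        have hBk := hB k (Equiv.swap 0 j)
        rw [Equiv.swap_apply_left] at hBk
        rw [sub_eq_add_neg, ← C_neg, coeff_C_mul, coeff_X_add_C_pow, Polynomial.eval_mul, hBk,
          Polynomial.eval_mul, eval_C, eval_pow, eval_neg, eval_X, mul_comm ((-eps R n j) ^ _)]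
    have hX : X ^ (n + 1) ∣ P.map π := by
      rw [← map_fundPoly R n π hπ]
      exact Polynomial.map_dvd π hdvd
    have h0 := X_pow_dvd_iff.1 hX (n - m) (by omega)
    have h1 : P.map π = ∑ m : Fin (n + 1), C (π (Φ l m)) * X ^ (n - m : ℕ) -
        ∑ k : Fin (n + 1), C (c k) * (C (((k : ℕ).choose l : ℕ) : K) *
          (C ((-1) ^ (k - l : ℕ)) * X ^ (k - l : ℕ))) := by
      rw [hP, Polynomial.map_sub, Polynomial.map_sum, Polynomial.map_sum]
      congr 1
      · refine Finset.sum_congr rfl fun m _ => ?_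
        rw [Polynomial.map_mul, map_C, map_pointCoeff R n π hπ (Nat.lt_succ_iff.1 m.isLt)]
      · refine Finset.sum_congr rfl fun k _ => ?_
        rw [Polynomial.map_mul, hc, Polynomial.map_mul, map_C, map_natCast, Polynomial.map_pow,
          Polynomial.map_neg, map_X, neg_pow]
        simp
    rw [h1, coeff_sub, sub_eq_zero, finsetSum_coeff, finsetSum_coeff] at h0
    simp only [coeff_C_mul, coeff_X_pow] at h0
    rw [← h0, Finset.sum_eq_single m]
    · simp
    · intro i _ hi
      rw [if_neg, mul_zero]
      intro e
      exact hi (Fin.ext (by omega))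
    · simp
  -- The truncated `k - l` is harmless, as the binomial vanishes for `k < l`. Otherwise `k - l ≤ n -
  -- l ≤ n - m`, with equality throughout only for `k = n` and `m = l`.
  have hterm : ∀ l m k : Fin (n + 1), m ≤ l → (m < l ∨ k ≠ Fin.last n) →
      c k * (((k : ℕ).choose l : K) *
        ((-1) ^ (k - l : ℕ) * if n - m = (k - l : ℕ) then 1 else 0)) = 0 := by
    intro l m k hml h
    rw [Fin.le_def] at hml
    rw [Fin.lt_def, Ne, Fin.ext_iff, Fin.val_last] at h
    by_cases hkl : (k : ℕ) < l
    · rw [Nat.choose_eq_zero_of_lt hkl, Nat.cast_zero, zero_mul, mul_zero]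
    · rw [if_neg (by omega), mul_zero, mul_zero, mul_zero]
  refine ⟨c (Fin.last n) * (-1) ^ n, fun l m hml => ?_, fun l => ?_⟩
  · rw [Matrix.map_apply, hcoeff]
    exact Finset.sum_eq_zero fun k _ => hterm l m k hml.le (Or.inl hml)
  · rw [Matrix.map_apply, hcoeff, Finset.sum_eq_single (Fin.last n)
      (fun k _ hk => hterm l l k le_rfl (Or.inr hk)) (by simp)]
    have hl : (l : ℕ) ≤ n := Nat.lt_succ_iff.1 l.isLt
    rw [Fin.val_last, if_pos rfl, mul_one, choose_prime_pow_sub_one_cast hp hn hl, ← pow_add,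
      Nat.add_sub_of_le hl]

end Endomorphisms

/-- Over a Noetherian domain with a homomorphism to a field of characteristic `p`, the dual is
indecomposable if `n + 1` is a power of `p`. -/
theorem isIndecomposable_DPDual (R : Type*) [CommRing R] [IsDomain R] [IsNoetherianRing R]
    {K : Type*} [Field K] (ρ : R →+* K) {p r n : ℕ} [CharP K p] (hp : p.Prime)
    (hn : n + 1 = p ^ r) : IsIndecomposable (D R n) (DPDual R n) := by
  refine ⟨⟨evHom R n 1, 0, fun h => ?_⟩, fun N₁ N₂ h => ?_⟩
  · rw [← map_zero (evHom R n)] at h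
    refine one_ne_zero (evHom_injOn R n ?_ ?_ h)
    · rw [degree_one]
      exact_mod_cast n.succ_pos
    · simp
  -- The projection onto `N₁` along `N₂` is `D`-linear; it is zero if `N₁` is, and the identity if
  -- `N₂` is zero.
  · set φ := N₁.projection N₂ h with hφ
    obtain ⟨Φ, hΦ⟩ := exists_matrix R n φ
    have hidem : ∀ z, φ (φ z) = φ z := fun z =>
      DFunLike.congr_fun (Submodule.isIdempotentElem_projection h) z
    have hmul := matrix_mul_self hΦ hidem
    -- All roots go to zero and the constants go to `K` by `ρ`.
    set π : S R n →+* K := MvPolynomial.eval₂Hom ρ 0 with hπ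
    obtain ⟨c, hlow, hdiag⟩ := map_matrix_upper π hp hn (by simp [hπ]) hΦ
    have hbar : Φ.map π * Φ.map π = Φ.map π := by rw [← Matrix.map_mul, hmul]
    rcases apply_eq_of_matrix hΦ (Φ.eq_zero_or_one_of_idempotent_of_map π hmul
      ((Φ.map π).eq_zero_or_one_of_idempotent_of_upper hbar c hlow hdiag)) with h0 | h1
    · left
      refine (Submodule.eq_bot_iff _).2 fun x hx => ?_
      rw [← Submodule.projection_apply_of_mem_left h hx]
      exact h0 x
    · right
      refine (Submodule.eq_bot_iff _).2 fun x hx => ?_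
      rw [← h1 x]
      exact (Submodule.projection_apply_eq_zero_iff h).2 hx

end NilHecke

end

theorem mainTheorem9 (p r n : ℕ) (hp : p.Prime) (hr : 1 ≤ r) (hn : n + 1 = p ^ r) :
    NilHecke.IsIndecomposable (NilHecke.D ℤ n) (NilHecke.DPDual ℤ n) ∧
    NilHecke.IsIndecomposable (NilHecke.D (ZMod p) n) (NilHecke.DPDual (ZMod p) n) := by
  have : Fact p.Prime := ⟨hp⟩
  exact ⟨NilHecke.isIndecomposable_DPDual ℤ (Int.castRingHom (ZMod p)) hp hn,
    NilHecke.isIndecomposable_DPDual (ZMod p) (RingHom.id (ZMod p)) hp hn⟩
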